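/- Let $(R,\mathfrak m)$ and $(S,\mathfrak n)$ be commutative Noetherian local rings and let $\varphi\colon R\to S$ be a flat local ring homomorphism. Call a finitely generated $S$-module $N$ extended (from $R$) if there is an $R$-module $M$ such that $S\otimes_R M\cong N$ as $S$-modules. Let $N_1$ and $N_2$ be finitely generated $S$-modules, and put $N=N_1\oplus N_2$. If two of the modules $N_1$, $N_2$, $N$ are extended, then so is the third. -/

import Mathlib

open scoped TensorProduct

universe u v w w₁ w₂

/-- Let `S` be an `R`-algebra. An `S`-module `N` is extended (from `R`) if there is an `R`-module `M`
such that `S ⊗[R] M` and `N` are isomorphic as `S`-modules.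

The module `M` is taken in the universe of `R`. When `R → S` is flat local and `N` is finitely
generated, every such `M` is finitely generated, so this is no restriction
(see `IsExtended.of_linearEquiv`). -/
def IsExtended (R : Type u) (S : Type v) [CommRing R] [CommRing S] [Algebra R S]
    (N : Type w) [AddCommGroup N] [Module S N] : Prop :=
  ∃ (M : Type u) (_ : AddCommGroup M) (_ : Module R M), Nonempty ((S ⊗[R] M) ≃ₗ[S] N)

/-- The universe of the `R`-module witnessing that a finitely generated module is extended does not
matter. -/
theorem IsExtended.of_linearEquiv (R : Type u) (S : Type v) [CommRing R] [CommRing S]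
    [Algebra R S] [IsLocalRing R] [IsLocalRing S] [IsLocalHom (algebraMap R S)] [Module.Flat R S]
    (N : Type w) [AddCommGroup N] [Module S N] [Module.Finite S N]
    (M : Type w₁) [AddCommGroup M] [Module R M] (e : (S ⊗[R] M) ≃ₗ[S] N) :
    IsExtended R S N := by
  have : Module.FaithfullyFlat R S := Module.FaithfullyFlat.of_flat_of_isLocalHom
  have : Module.Finite S (S ⊗[R] M) := Module.Finite.equiv e.symm
  have : Module.Finite R M := Module.Finite.of_finite_tensorProduct_of_faithfullyFlat S
  obtain ⟨n, f, hf⟩ := Module.Finite.exists_fin' R M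
  exact ⟨_, inferInstance, inferInstance,
    ⟨((f.quotKerEquivOfSurjective hf).baseChange R S _ _).trans e⟩⟩

/-! ### Rank functions and stable range for semisimple algebras. -/

section SemisimpleAlgebra

open Module

/-! Sums are clear, since tensor products commute with them; the content is that complements are
extended. If `N₁` and `N₁ × N₂` come from `M₁` and `M`, then `S ⊗ M₁` is a summand of `S ⊗ M`. By
flatness the splitting is an equation `∑ sᵢ tⱼ ⊗ gᵢ fⱼ = 1` in `S ⊗ End M₁`. It is reduced to a
semisimple quotient of `End M₁`, where comparing dimensions of `e U` removes the residue field
extension (`exists_sum_mul_mul_eq_one`). A solution lifts and gives `M ≅ M₁ × K`. Hence `N₁ × (S ⊗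
K) ≅ N₁ × N₂`, and `N₁` cancels because the semisimple quotient of its endomorphism ring has stable
range one (`nonempty_linearEquiv_of_prod`). -/

/-- The dimension of `e U`, for an element `e` of an algebra acting on `U`. -/
noncomputable def smulRank (k : Type*) {Q : Type*} (U : Type*) [Field k] [Ring Q] [Algebra k Q]
    [AddCommGroup U] [Module k U] [Module Q U] [IsScalarTower k Q U] (e : Q) : ℕ :=
  finrank k (LinearMap.range (Algebra.lsmul k k U e))

variable {k Q U V : Type*} [Field k] [Ring Q] [Algebra k Q]
  [AddCommGroup U] [Module k U] [Module Q U] [IsScalarTower k Q U]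
  [AddCommGroup V] [Module k V] [Module Q V] [IsScalarTower k Q V]

theorem smulRank_congr (f : U ≃ₗ[Q] V) (e : Q) : smulRank k U e = smulRank k V e := by
  let g : U ≃ₗ[k] V := f.restrictScalars k
  have h : LinearMap.range (Algebra.lsmul k k V e) =
      (LinearMap.range (Algebra.lsmul k k U e)).map g.toLinearMap := by
    ext v
    constructor
    · rintro ⟨x, rfl⟩
      exact ⟨_, ⟨g.symm x, rfl⟩, by simp [g]⟩
    · rintro ⟨_, ⟨x, rfl⟩, rfl⟩
      exact ⟨g x, by simp [g]⟩
  rw [smulRank, smulRank, h]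
  exact (g.submoduleMap _).finrank_eq

theorem smulRank_prod [FiniteDimensional k U] [FiniteDimensional k V] (e : Q) :
    smulRank k (U × V) e = smulRank k U e + smulRank k V e := by
  let f := Algebra.lsmul k k U e
  let g := Algebra.lsmul k k V e
  let j := (LinearMap.range f).subtype.prodMap (LinearMap.range g).subtype
  have hj : Function.Injective j :=
    (Submodule.injective_subtype _).prodMap (Submodule.injective_subtype _)
  have h : LinearMap.range (Algebra.lsmul k k (U × V) e) = LinearMap.range j := by
    ext x
    constructor
    · rintro ⟨y, rfl⟩
      exact ⟨(⟨_, y.1, rfl⟩, ⟨_, y.2, rfl⟩), rfl⟩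
    · rintro ⟨⟨⟨_, y, rfl⟩, ⟨_, z, rfl⟩⟩, rfl⟩
      exact ⟨(y, z), rfl⟩
  rw [smulRank, h, LinearMap.finrank_range_of_inj hj, finrank_prod]
  rfl

theorem smulRank_add_of_isCompl [FiniteDimensional k U] {S T : Submodule Q U} (h : IsCompl S T)
    (e : Q) : smulRank k S e + smulRank k T e = smulRank k U e := by
  have : FiniteDimensional k S := inferInstanceAs (FiniteDimensional k (S.restrictScalars k))
  have : FiniteDimensional k T := inferInstanceAs (FiniteDimensional k (T.restrictScalars k))
  rw [← smulRank_prod, smulRank_congr (Submodule.prodEquivOfIsCompl S T h)]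

theorem smulRank_eq_zero [FiniteDimensional k U] {e : Q} :
    smulRank k U e = 0 ↔ ∀ x : U, e • x = 0 := by
  rw [smulRank, Submodule.finrank_eq_zero, LinearMap.range_eq_bot, LinearMap.ext_iff]
  rfl

/-- A finite-dimensional module over a semisimple algebra is determined up to embeddings by the
dimensions of its images under the elements of the algebra. -/
theorem exists_injective_of_smulRank_le {k Q U V : Type*} [Field k] [Ring Q] [Algebra k Q]
    [AddCommGroup U] [Module k U] [Module Q U] [IsScalarTower k Q U]
    [AddCommGroup V] [Module k V] [Module Q V] [IsScalarTower k Q V] [IsSemisimpleRing Q] [FiniteDimensional k U]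
    [FiniteDimensional k V] (h : ∀ e : Q, smulRank k U e ≤ smulRank k V e) :
    ∃ f : U →ₗ[Q] V, Function.Injective f := by
  rcases subsingleton_or_nontrivial U with hU | hU
  · exact ⟨0, fun _ _ _ ↦ Subsingleton.elim _ _⟩
  obtain ⟨T, hT⟩ := IsSemisimpleModule.exists_simple_submodule Q U
  obtain ⟨I, ⟨φ⟩⟩ := IsSemisimpleRing.exists_linearEquiv_ideal_of_isSimpleModule Q T
  obtain ⟨e, he, hI⟩ := IsSemisimpleRing.ideal_eq_span_idempotent I
  have : Nontrivial T := IsSimpleModule.nontrivial Q T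
  have heI : e ∈ I := hI ▸ Ideal.mem_span_singleton_self e
  have he0 : e ≠ 0 := by
    rintro rfl
    have : Subsingleton I := by rw [hI, Ideal.span_singleton_zero]; infer_instance
    exact not_subsingleton T φ.toEquiv.subsingleton
  -- The idempotent `e` acts nontrivially on `T ≅ Qe`, so the rank inequality forces `eV ≠ 0`. A `y`
  -- with `ey ≠ 0` embeds `T` in `V`; splitting off both copies leaves a smaller `U`.
  have hV : ¬ ∀ y : V, e • y = 0 := by
    intro hy
    have hz := h e
    rw [smulRank_eq_zero.mpr hy, Nat.le_zero, smulRank_eq_zero] at hz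
    have h1 : e • (φ.symm ⟨e, heI⟩) = 0 := Subtype.ext (hz _)
    rw [← map_smul, LinearEquiv.map_eq_zero_iff, Subtype.ext_iff] at h1
    exact he0 (by simpa [he.eq] using h1)
  push Not at hV
  obtain ⟨y, hy⟩ := hV
  let g : T →ₗ[Q] V := (LinearMap.toSpanSingleton Q V y) ∘ₗ I.subtype ∘ₗ φ.toLinearMap
  have hg : Function.Injective g := LinearMap.injective_of_ne_zero fun h0 ↦ hy <| by
    simpa [g] using LinearMap.congr_fun h0 (φ.symm ⟨e, heI⟩)
  obtain ⟨U', hU'⟩ := exists_isCompl T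
  obtain ⟨V', hV'⟩ := exists_isCompl (LinearMap.range g)
  let γ : T ≃ₗ[Q] LinearMap.range g := LinearEquiv.ofInjective g hg
  have : FiniteDimensional k T := inferInstanceAs (FiniteDimensional k (T.restrictScalars k))
  have : FiniteDimensional k U' := inferInstanceAs (FiniteDimensional k (U'.restrictScalars k))
  have : FiniteDimensional k V' := inferInstanceAs (FiniteDimensional k (V'.restrictScalars k))
  have hlt : finrank k U' < finrank k U := by
    have h1 := ((Submodule.prodEquivOfIsCompl T U' hU').restrictScalars k).finrank_eq
    rw [finrank_prod] at h1
    have : 0 < finrank k T := finrank_pos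
    omega
  have hle (e : Q) : smulRank k U' e ≤ smulRank k V' e := by
    have h1 := smulRank_add_of_isCompl (k := k) hU' e
    have h2 := smulRank_add_of_isCompl (k := k) hV' e
    have h3 := smulRank_congr (k := k) γ e
    have h4 := h e
    omega
  obtain ⟨f, hf⟩ : ∃ f : U' →ₗ[Q] V', Function.Injective f := exists_injective_of_smulRank_le hle
  let p := Submodule.prodEquivOfIsCompl _ V' hV'
  let q := (Submodule.prodEquivOfIsCompl T U' hU').symm
  exact ⟨p.toLinearMap ∘ₗ (γ.toLinearMap.prodMap f) ∘ₗ q.toLinearMap,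
    p.injective.comp ((γ.injective.prodMap hf).comp q.injective)⟩
termination_by finrank k U

/-- A semisimple finite-dimensional algebra has stable range one. -/
theorem exists_isUnit_add_mul (k : Type*) {Q : Type*} [Field k] [Ring Q] [Algebra k Q]
    [IsSemisimpleRing Q] [FiniteDimensional k Q] {a c x : Q} (h : x * a + c = 1) :
    ∃ y : Q, IsUnit (a + y * c) := by
  let A : Ideal Q := Ideal.span {a}
  let ρ : Q →ₗ[Q] A :=
    { toFun z := ⟨z * a, Ideal.mem_span_singleton'.mpr ⟨z, rfl⟩⟩
      map_add' z w := Subtype.ext (add_mul z w a)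
      map_smul' z w := Subtype.ext (mul_assoc z w a) }
  have hρ : Function.Surjective ρ := by
    rintro ⟨z, hz⟩
    obtain ⟨w, rfl⟩ := Ideal.mem_span_singleton'.mp hz
    exact ⟨w, rfl⟩
  -- As `Qa + Qc = Q`, a complement of `Qa` can be chosen inside `Qc`.
  obtain ⟨C, hCc, hC⟩ : ∃ C ≤ Ideal.span {c}, IsCompl A C := by
    have htop : A ⊔ Ideal.span {c} = ⊤ := by
      rw [Ideal.eq_top_iff_one, ← h]
      exact add_mem (Ideal.mem_sup_left (Ideal.mem_span_singleton'.mpr ⟨x, rfl⟩))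
        (Ideal.mem_sup_right (Ideal.mem_span_singleton_self c))
    obtain ⟨D, hD⟩ := exists_isCompl (A ⊓ Ideal.span {c})
    refine ⟨Ideal.span {c} ⊓ D, inf_le_left, ?_, ?_⟩
    · rw [disjoint_iff, ← inf_assoc, hD.inf_eq_bot]
    · rw [codisjoint_iff, eq_top_iff, ← htop]
      refine sup_le le_sup_left ?_
      calc Ideal.span {c} = Ideal.span {c} ⊓ ((A ⊓ Ideal.span {c}) ⊔ D) := by
            rw [hD.sup_eq_top, inf_top_eq]
        _ = (A ⊓ Ideal.span {c}) ⊔ (Ideal.span {c} ⊓ D) := by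
            rw [inf_comm, sup_inf_assoc_of_le _ inf_le_right, inf_comm D]
        _ ≤ _ := sup_le_sup_right inf_le_left _
  obtain ⟨B, hB⟩ := exists_isCompl (LinearMap.ker ρ)
  have : FiniteDimensional k C := inferInstanceAs (FiniteDimensional k (C.restrictScalars k))
  have : FiniteDimensional k (LinearMap.ker ρ) :=
    inferInstanceAs (FiniteDimensional k ((LinearMap.ker ρ).restrictScalars k))
  -- `ker ρ` and `C` both complement a copy of `Qa` in `Q`.
  have hle (e : Q) : smulRank k (LinearMap.ker ρ) e ≤ smulRank k C e := by
    have h1 := smulRank_add_of_isCompl (k := k) hB e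
    have h2 := smulRank_add_of_isCompl (k := k) hC e
    have h3 : smulRank k B e = smulRank k A e := smulRank_congr
      ((Submodule.quotientEquivOfIsCompl _ B hB).symm.trans (ρ.quotKerEquivOfSurjective hρ)) e
    omega
  obtain ⟨j, hj⟩ : ∃ j : LinearMap.ker ρ →ₗ[Q] C, Function.Injective j :=
    exists_injective_of_smulRank_le hle
  obtain ⟨ψ, hψ⟩ := IsSemisimpleModule.extension_property (LinearMap.ker ρ).subtype
    (Submodule.injective_subtype _) (LinearMap.id (R := Q))
  -- The map `j ∘ ψ` is right multiplication by its value at `1`, which lies in `Qc`; this yields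
  -- `y`.
  obtain ⟨y, hy⟩ := Ideal.mem_span_singleton'.mp (hCc (j (ψ 1)).2)
  have hy' (z : Q) : z * (y * c) = j (ψ z) := by
    rw [hy]
    conv_rhs => rw [← mul_one z, ← smul_eq_mul, map_smul, map_smul]
    rfl
  refine ⟨y, ?_⟩
  let τ : Q →ₗ[k] Q := LinearMap.mulRight k (a + y * c)
  have hτ : Function.Injective τ := by
    rw [← LinearMap.ker_eq_bot, LinearMap.ker_eq_bot']
    intro z hz
    have hz' : z * a + j (ψ z) = 0 := by rw [← hy', ← mul_add]; exact hz
    have hza : z * a = 0 := by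
      refine Submodule.disjoint_def.mp hC.disjoint _ (ρ z).2 ?_
      rw [eq_neg_of_add_eq_zero_left hz']
      exact neg_mem (j (ψ z)).2
    have hzk : z ∈ LinearMap.ker ρ := Subtype.ext hza
    have h0 : j (ψ z) = 0 := Subtype.ext (by simpa [hza] using hz')
    have h1 : ψ z = ⟨z, hzk⟩ := LinearMap.congr_fun hψ ⟨z, hzk⟩
    rw [h1, LinearMap.map_eq_zero_iff _ hj] at h0
    exact congrArg Subtype.val h0
  obtain ⟨w, hw⟩ := LinearMap.surjective_of_injective hτ 1
  have hw' : w * (a + y * c) = 1 := hw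
  exact IsUnit.of_mul_eq_one w (hτ (by simp [τ, mul_assoc, hw']))

/-- A bilinear equation `s q t = 1` that has a solution with scalars `s`, `t` in an extension of the
base field has a solution in the algebra. -/
theorem exists_sum_mul_mul_eq_one {k l Q ι κ : Type*} [Field k] [Field l] [Algebra k l] [Ring Q]
    [Algebra k Q] [IsSemisimpleRing Q] [FiniteDimensional k Q] [Fintype ι] [Fintype κ]
    (q : ι → κ → Q) (s : ι → l) (t : κ → l)
    (h : ∑ i, ∑ j, (s i * t j) ⊗ₜ[k] q i j = (1 : l) ⊗ₜ[k] (1 : Q)) :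
    ∃ (x : ι → Q) (y : κ → Q), ∑ i, ∑ j, x i * q i j * y j = 1 := by
  classical
  let C : Submodule Q (κ → Q) := Submodule.span Q (Set.range q)
  have hq (i : ι) : q i ∈ C := Submodule.subset_span ⟨i, rfl⟩
  have : FiniteDimensional k C := inferInstanceAs (FiniteDimensional k (C.restrictScalars k))
  -- Over `l`, combining right multiplications by the rows `q i` with weights `s i` maps `eQ` to
  -- `eC`. Coordinates weighted by `t j` undo this, so it is injective.
  have hle (e : Q) : smulRank k Q e ≤ smulRank k C e := by
    let U := LinearMap.range (Algebra.lsmul k k Q e)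
    let W := LinearMap.range (Algebra.lsmul k k C e)
    let ρ (i : ι) : U →ₗ[k] W :=
      { toFun x := ⟨⟨x.1 • q i, C.smul_mem _ (hq i)⟩, by
          obtain ⟨_, z, rfl⟩ := x
          exact ⟨⟨z • q i, C.smul_mem _ (hq i)⟩, Subtype.ext (smul_smul e z (q i))⟩⟩
        map_add' x y := Subtype.ext (Subtype.ext (add_smul x.1 y.1 (q i)))
        map_smul' r x := Subtype.ext (Subtype.ext (smul_assoc r x.1 (q i))) }
    let p (j : κ) : W →ₗ[k] Q :=
      LinearMap.proj j ∘ₗ (C.restrictScalars k).subtype ∘ₗ W.subtype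
    let Φ : l ⊗[k] U →ₗ[l] l ⊗[k] W := ∑ i, s i • (ρ i).baseChange l
    let Ψ : l ⊗[k] W →ₗ[l] l ⊗[k] Q := ∑ j, t j • (p j).baseChange l
    have hΨΦ : Ψ ∘ₗ Φ = U.subtype.baseChange l := by
      ext x
      have hx := congrArg (LinearMap.lTensor l (LinearMap.mulLeft k (x : Q))) h
      simp only [map_sum, LinearMap.lTensor_tmul, LinearMap.mulLeft_apply, mul_one] at hx
      simp only [Φ, Ψ, TensorProduct.AlgebraTensorModule.curry_apply, LinearMap.coe_comp,
        TensorProduct.curry_apply, LinearMap.coe_restrictScalars, Function.comp_apply,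
        LinearMap.sum_apply, LinearMap.smul_apply, LinearMap.baseChange_tmul, map_sum, map_smul,
        Submodule.subtype_apply]
      rw [← hx]
      simp only [Finset.smul_sum, TensorProduct.smul_tmul', smul_eq_mul, mul_one]
      rfl
    have hinj : Function.Injective Φ := by
      refine Function.Injective.of_comp (f := Ψ) ?_
      rw [← LinearMap.coe_comp, hΨΦ]
      exact Module.Flat.lTensor_preserves_injective_linearMap _ (Submodule.injective_subtype _)
    have hΦ := LinearMap.finrank_le_finrank_of_injective hinj
    have : Module.Free k W := Module.Free.of_divisionRing k W
    rwa [finrank_baseChange, finrank_baseChange] at hΦ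
  obtain ⟨f, hf⟩ : ∃ f : Q →ₗ[Q] C, Function.Injective f := exists_injective_of_smulRank_le hle
  obtain ⟨x, hx⟩ := (Submodule.mem_span_range_iff_exists_fun Q).mp (f 1).2
  -- The `x i` are coefficients of `f 1` in the rows; a retraction of `κ → Q` onto `Q` supplies the
  -- `y j` as images of unit vectors.
  obtain ⟨g, hg⟩ := IsSemisimpleModule.extension_property (C.subtype ∘ₗ f)
    ((Submodule.injective_subtype _).comp hf) LinearMap.id
  have hg1 : g (f 1) = 1 := LinearMap.congr_fun hg 1
  refine ⟨x, fun j ↦ g (Pi.single j 1), Eq.trans ?_ hg1⟩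
  rw [← hx, map_sum]
  refine Finset.sum_congr rfl fun i _ ↦ ?_
  conv_rhs => rw [map_smul, pi_eq_sum_univ' (q i), map_sum, Finset.smul_sum]
  refine Finset.sum_congr rfl fun j _ ↦ ?_
  rw [map_smul, smul_eq_mul, smul_eq_mul, mul_assoc]

end SemisimpleAlgebra

/-! ### Endomorphism rings over local rings and cancellation. -/

section LocalRing

open Module IsLocalRing

/-- The endomorphism ring of a finitely generated module over a Noetherian local ring has a
semisimple quotient that is finite-dimensional over the residue field and detects automorphisms. -/
theorem exists_semisimple_quotient_end (R : Type u) [CommRing R] [IsLocalRing R]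
    [IsNoetherianRing R] (M : Type w) [AddCommGroup M] [Module R M] [Module.Finite R M] :
    ∃ (Q : Type (max u w)) (_ : Ring Q) (_ : Algebra (ResidueField R) Q)
      (π : Module.End R M →+* Q), IsSemisimpleRing Q ∧ FiniteDimensional (ResidueField R) Q ∧
      Function.Surjective π ∧ (∀ (r : R) (f : Module.End R M), π (r • f) = residue R r • π f) ∧
      ∀ f : Module.End R M, IsUnit (π f) → Function.Bijective f := by
  let k := ResidueField R
  let E := k ⊗[R] Module.End R M
  have : IsArtinianRing E := IsArtinianRing.of_finite k E
  let ι : Module.End R M →+* E := Algebra.TensorProduct.includeRight.toRingHom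
  have hι : Function.Surjective ι := TensorProduct.mk_surjective R _ k Ideal.Quotient.mk_surjective
  let q : E →+* E ⧸ Ring.jacobson E := Ideal.Quotient.mk _
  have hq : Function.Surjective q := Ideal.Quotient.mk_surjective
  refine ⟨E ⧸ Ring.jacobson E, inferInstance, inferInstance, q.comp ι, inferInstance,
    ?_, hq.comp hι, fun r f ↦ ?_, fun f hf ↦ ?_⟩
  · exact Module.Finite.of_surjective (Ideal.Quotient.mkₐ k (Ring.jacobson E)).toLinearMap hq
  · have : ι (r • f) = residue R r • ι f := by
      change (1 : k) ⊗ₜ[R] (r • f) = residue R r • ((1 : k) ⊗ₜ[R] f)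
      rw [TensorProduct.tmul_smul, TensorProduct.smul_tmul', TensorProduct.smul_tmul',
        Algebra.smul_def, smul_eq_mul]
      rfl
    rw [RingHom.comp_apply, this]
    rfl
  · obtain ⟨z, hz⟩ := hf.exists_right_inv
    obtain ⟨y, rfl⟩ := hq z
    have hmem : ι f * y - 1 ∈ Ring.jacobson E := by
      refine Ideal.Quotient.eq.mp ?_
      exact (q.map_mul _ _).trans (hz.trans q.map_one.symm)
    -- The radical of the Artinian ring `E` is nilpotent, so `ι f` is right invertible. Thus `f` is
    -- onto modulo the maximal ideal, and Nakayama applies.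
    have hnil : IsNilpotent (ι f * y - 1) := by
      obtain ⟨n, hn⟩ := IsSemiprimaryRing.isNilpotent (R := E)
      exact ⟨n, by simpa [hn] using Ideal.pow_mem_pow hmem n⟩
    have hu : IsUnit (ι f * y) := by simpa using hnil.isUnit_one_add
    obtain ⟨z, hz⟩ := hu.exists_right_inv
    have hsurj : Function.Surjective (f.baseChange k) := by
      intro v
      let T := LinearMap.tensorProductEnd R k M
      have hT : T (ι f) = f.baseChange k := one_smul k _
      refine ⟨T (y * z) v, ?_⟩
      rw [← hT, ← Module.End.mul_apply, ← map_mul, ← mul_assoc, hz, map_one, Module.End.one_apply]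
    have hf' : Function.Surjective f := by
      rw [← LinearMap.range_eq_top, ← IsLocalRing.map_tensorProduct_mk_eq_top, eq_top_iff]
      rintro v -
      obtain ⟨u, rfl⟩ := hsurj v
      obtain ⟨m, rfl⟩ := TensorProduct.mk_surjective R M k Ideal.Quotient.mk_surjective u
      exact ⟨f m, ⟨m, rfl⟩, rfl⟩
    exact IsNoetherian.bijective_of_surjective_endomorphism f hf'

/-- Finitely generated modules over a Noetherian local ring cancel from direct sums. -/
theorem nonempty_linearEquiv_of_prod {R A B C : Type*} [CommRing R] [IsLocalRing R]
    [IsNoetherianRing R] [AddCommGroup A] [Module R A] [Module.Finite R A]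
    [AddCommGroup B] [Module R B] [AddCommGroup C] [Module R C]
    (Φ : (A × B) ≃ₗ[R] A × C) : Nonempty (B ≃ₗ[R] C) := by
  obtain ⟨Q, _, _, π, hQ, hfin, hπ, -, hunit⟩ := exists_semisimple_quotient_end R A
  let α : Module.End R A := LinearMap.fst R A B ∘ₗ Φ.symm.toLinearMap ∘ₗ LinearMap.inl R A C
  let β : A →ₗ[R] B := LinearMap.snd R A B ∘ₗ Φ.symm.toLinearMap ∘ₗ LinearMap.inl R A C
  let γ : Module.End R A := LinearMap.fst R A C ∘ₗ Φ.toLinearMap ∘ₗ LinearMap.inl R A B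
  let δ : B →ₗ[R] A := LinearMap.fst R A C ∘ₗ Φ.toLinearMap ∘ₗ LinearMap.inr R A B
  have hαβ (a : A) : Φ.symm (a, 0) = (α a, β a) := rfl
  have hγδ (a : A) (b : B) : (Φ (a, b)).1 = γ a + δ b := by
    change _ = (Φ (a, 0)).1 + (Φ (0, b)).1
    rw [← Prod.fst_add, ← map_add, Prod.mk_add_mk, add_zero, zero_add]
  have h1 : γ * α + δ ∘ₗ β = 1 := by
    ext a
    change γ (α a) + δ (β a) = a
    rw [← hγδ, ← hαβ, Φ.apply_symm_apply]
  obtain ⟨y, hy⟩ := exists_isUnit_add_mul (ResidueField R) (a := π α) (c := π (δ ∘ₗ β))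
    (x := π γ) (by rw [← map_mul, ← map_add, h1, map_one])
  obtain ⟨η, rfl⟩ := hπ y
  rw [← map_mul, ← map_add] at hy
  have hu := hunit _ hy
  have hu' (a : A) : (α + η * (δ ∘ₗ β)) a = α a + η (δ (β a)) := rfl
  -- The image of `j` is the kernel of `(a, b) ↦ a + η (δ b)`. This map restricts to an automorphism
  -- on `Φ.symm (A × 0)`, so `j B` is a complement of it, as is `Φ.symm (0 × C)`.
  let j : B →ₗ[R] A × B := (-(η ∘ₗ δ)).prod LinearMap.id
  have hj (b : B) : j b = (-η (δ b), b) := rfl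
  let θ : B →ₗ[R] C := LinearMap.snd R A C ∘ₗ Φ.toLinearMap ∘ₗ j
  refine ⟨LinearEquiv.ofBijective θ ⟨?_, fun c ↦ ?_⟩⟩
  · rw [← LinearMap.ker_eq_bot, LinearMap.ker_eq_bot']
    intro b hb
    have h2 : j b = Φ.symm ((Φ (j b)).1, 0) := by
      rw [LinearEquiv.eq_symm_apply]
      exact Prod.ext rfl hb
    set a := (Φ (j b)).1
    rw [hαβ, hj, Prod.mk.injEq] at h2
    have ha : a = 0 := hu.1 (by rw [hu', map_zero, ← h2.1, ← h2.2, neg_add_cancel])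
    rw [h2.2, ha, map_zero]
  · obtain ⟨a, ha⟩ := hu.2 ((Φ.symm (0, c)).1 + η (δ (Φ.symm (0, c)).2))
    refine ⟨(Φ.symm (0, c)).2 - β a, ?_⟩
    have h2 : j ((Φ.symm (0, c)).2 - β a) = Φ.symm (0, c) - Φ.symm (a, 0) := by
      rw [hαβ, hj]
      refine Prod.ext ?_ rfl
      rw [hu'] at ha
      simp only [map_sub, Prod.fst_sub]
      rw [neg_sub, sub_eq_sub_iff_add_eq_add, add_comm, ha]
    change (Φ (j _)).2 = c
    rw [h2, ← map_sub, Φ.apply_symm_apply]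
    simp

/-! ### Descent of split monomorphisms along flat local maps. -/

theorem tensorProduct_hom_tmul {R S X Y : Type*} [CommRing R] [CommRing S] [Algebra R S]
    [AddCommGroup X] [Module R X] [AddCommGroup Y] [Module R Y] (s : S) (f : X →ₗ[R] Y) :
    LinearMap.tensorProduct R S X Y (s ⊗ₜ f) = s • f.baseChange S :=
  rfl

/-- Homomorphisms out of a finitely generated module over a Noetherian ring commute with flat base
change. -/
theorem bijective_tensorProduct (R S X Y : Type*) [CommRing R] [CommRing S] [IsNoetherianRing R]
    [Algebra R S] [Module.Flat R S] [AddCommGroup X] [Module R X] [Module.Finite R X]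
    [AddCommGroup Y] [Module R Y] : Function.Bijective (LinearMap.tensorProduct R S X Y) := by
  have : Module.FinitePresentation R X := Module.finitePresentation_of_finite R X
  have h := Module.FinitePresentation.isBaseChange_map R X Y S
  have h' : LinearMap.tensorProduct R S X Y = h.equiv.toLinearMap := by
    refine TensorProduct.AlgebraTensorModule.ext fun s f ↦ ?_
    rw [tensorProduct_hom_tmul, LinearEquiv.coe_coe, IsBaseChange.equiv_tmul]
    rfl
  rw [h']
  exact h.equiv.bijective

/-- A split monomorphism between the scalar extensions of finitely generated modules along a flat
local homomorphism yields one between the modules. -/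
theorem exists_bijective_comp_of_baseChange {R S : Type*} [CommRing R] [CommRing S]
    [IsLocalRing R] [IsLocalRing S] [IsNoetherianRing R]
    [Algebra R S] [IsLocalHom (algebraMap R S)] [Module.Flat R S]
    {M N : Type*} [AddCommGroup M] [Module R M] [Module.Finite R M]
    [AddCommGroup N] [Module R N] [Module.Finite R N]
    (i : (S ⊗[R] M) →ₗ[S] S ⊗[R] N) (p : (S ⊗[R] N) →ₗ[S] S ⊗[R] M)
    (hpi : p ∘ₗ i = LinearMap.id) :
    ∃ (f : M →ₗ[R] N) (g : N →ₗ[R] M), Function.Bijective (g ∘ₗ f) := by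
  obtain ⟨Q, _, _, π, hQ, hfin, hπ, hsmul, hunit⟩ := exists_semisimple_quotient_end R M
  obtain ⟨I, hI⟩ := (bijective_tensorProduct R S N M).2 p
  obtain ⟨J, hJ⟩ := (bijective_tensorProduct R S M N).2 i
  obtain ⟨s, rfl⟩ := TensorProduct.exists_finset I
  obtain ⟨t, rfl⟩ := TensorProduct.exists_finset J
  have hone : ∑ x : s, ∑ y : t, (x.1.1 * y.1.1) ⊗ₜ[R] (x.1.2 ∘ₗ y.1.2) =
      (1 : S) ⊗ₜ[R] (1 : Module.End R M) := by
    apply (bijective_tensorProduct R S M M).1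
    rw [map_sum, tensorProduct_hom_tmul, one_smul]
    simp_rw [map_sum, tensorProduct_hom_tmul, LinearMap.baseChange_comp]
    rw [Module.End.one_eq_id, LinearMap.baseChange_id, ← hpi, ← hI, ← hJ, map_sum, map_sum,
      ← Finset.sum_coe_sort s, ← Finset.sum_coe_sort t]
    simp_rw [tensorProduct_hom_tmul]
    ext m
    simp only [TensorProduct.AlgebraTensorModule.curry_apply, TensorProduct.curry_apply,
      LinearMap.coe_restrictScalars, LinearMap.sum_apply, LinearMap.comp_apply,
      LinearMap.smul_apply, map_sum, map_smul, Finset.smul_sum, smul_smul]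
    refine Finset.sum_comm.trans ?_
    simp only [mul_comm]
  -- Reduction of the splitting equation to the residue fields.
  let F : S ⊗[R] Module.End R M →+ ResidueField S ⊗[ResidueField R] Q :=
    TensorProduct.liftAddHom
      (AddMonoidHom.mk' (fun s ↦ AddMonoidHom.mk' (fun e ↦ residue S s ⊗ₜ π e)
        fun a b ↦ by rw [map_add, TensorProduct.tmul_add])
        fun a b ↦ by ext; simp [TensorProduct.add_tmul])
      fun r s e ↦ by
        change residue S (r • s) ⊗ₜ π e = residue S s ⊗ₜ π (r • e)
        rw [hsmul, ← TensorProduct.smul_tmul]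
        congr 1
  have hF (s : S) (e : Module.End R M) : F (s ⊗ₜ e) = residue S s ⊗ₜ π e := rfl
  have hone' := congrArg F hone
  simp only [map_sum, hF, map_mul, map_one] at hone'
  obtain ⟨x, y, hxy⟩ := exists_sum_mul_mul_eq_one _ _ _ hone'
  choose x' hx' using fun a ↦ hπ (x a)
  choose y' hy' using fun a ↦ hπ (y a)
  refine ⟨∑ b, b.1.2 ∘ₗ y' b, ∑ a, x' a ∘ₗ a.1.2, hunit _ ?_⟩
  convert! isUnit_one
  rw [← hxy]
  simp_rw [← hx', ← hy', ← map_mul, ← map_sum]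
  congr 1
  ext m
  simp only [LinearMap.sum_apply, LinearMap.comp_apply, Module.End.mul_apply, map_sum]
  exact Finset.sum_comm

end LocalRing

/-! ### Direct summands and extended modules. -/

/-- A split epimorphism decomposes its source as the target times the kernel. -/
theorem nonempty_linearEquiv_prod_ker {R M N : Type*} [Ring R] [AddCommGroup M] [Module R M]
    [AddCommGroup N] [Module R N] {f : M →ₗ[R] N} {g : N →ₗ[R] M}
    (h : Function.Bijective (g ∘ₗ f)) : Nonempty (N ≃ₗ[R] M × LinearMap.ker g) := by
  let e := LinearEquiv.ofBijective _ h
  have he (m : M) : g (f (e.symm m)) = m := e.apply_symm_apply m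
  refine ⟨(LinearEquiv.ofBijective ((f ∘ₗ e.symm.toLinearMap).coprod (LinearMap.ker g).subtype)
    ⟨?_, fun n ↦ ?_⟩).symm⟩
  · rw [← LinearMap.ker_eq_bot, LinearMap.ker_eq_bot']
    rintro ⟨m, n, hn⟩ hmn
    have hmn' : f (e.symm m) + n = 0 := hmn
    have hm : m = 0 := by simpa [he, LinearMap.mem_ker.mp hn] using congrArg g hmn'
    subst hm
    simpa using hmn'
  · refine ⟨(g n, ⟨n - f (e.symm (g n)), by simp [he]⟩), ?_⟩
    simp

theorem IsExtended.congr {R : Type u} {S : Type v} [CommRing R] [CommRing S] [Algebra R S]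
    {N : Type w₁} {N' : Type w₂} [AddCommGroup N] [Module S N] [AddCommGroup N'] [Module S N']
    (h : IsExtended R S N) (e : N ≃ₗ[S] N') : IsExtended R S N' := by
  obtain ⟨M, _, _, ⟨φ⟩⟩ := h
  exact ⟨M, _, _, ⟨φ.trans e⟩⟩

theorem IsExtended.prod {R : Type u} {S : Type v} [CommRing R] [CommRing S] [Algebra R S]
    {N₁ : Type w₁} {N₂ : Type w₂} [AddCommGroup N₁] [Module S N₁] [AddCommGroup N₂] [Module S N₂]
    (h₁ : IsExtended R S N₁) (h₂ : IsExtended R S N₂) : IsExtended R S (N₁ × N₂) := by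
  obtain ⟨M₁, _, _, ⟨e₁⟩⟩ := h₁
  obtain ⟨M₂, _, _, ⟨e₂⟩⟩ := h₂
  exact ⟨M₁ × M₂, _, _, ⟨(TensorProduct.prodRight R S S M₁ M₂).trans (e₁.prodCongr e₂)⟩⟩

/-- A direct complement of an extended summand of an extended module is extended. -/
theorem IsExtended.of_prod_left {R : Type u} {S : Type v} [CommRing R] [CommRing S]
    [IsLocalRing R] [IsLocalRing S] [IsNoetherianRing R] [IsNoetherianRing S]
    [Algebra R S] [IsLocalHom (algebraMap R S)] [Module.Flat R S]
    {N₁ : Type w₁} {N₂ : Type w₂} [AddCommGroup N₁] [AddCommGroup N₂] [Module S N₁] [Module S N₂]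
    [Module.Finite S N₁] [Module.Finite S N₂]
    (h₁ : IsExtended R S N₁) (h : IsExtended R S (N₁ × N₂)) : IsExtended R S N₂ := by
  obtain ⟨M₁, _, _, ⟨e₁⟩⟩ := h₁
  obtain ⟨M, _, _, ⟨e⟩⟩ := h
  have : Module.FaithfullyFlat R S := Module.FaithfullyFlat.of_flat_of_isLocalHom
  have : Module.Finite S (S ⊗[R] M₁) := Module.Finite.equiv e₁.symm
  have : Module.Finite S (S ⊗[R] M) := Module.Finite.equiv e.symm
  have : Module.Finite R M₁ := Module.Finite.of_finite_tensorProduct_of_faithfullyFlat S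
  have : Module.Finite R M := Module.Finite.of_finite_tensorProduct_of_faithfullyFlat S
  obtain ⟨f, g, hfg⟩ := exists_bijective_comp_of_baseChange
    (e.symm.toLinearMap ∘ₗ LinearMap.inl S N₁ N₂ ∘ₗ e₁.toLinearMap)
    (e₁.symm.toLinearMap ∘ₗ LinearMap.fst S N₁ N₂ ∘ₗ e.toLinearMap)
    (LinearMap.ext fun x ↦ by simp)
  obtain ⟨φ⟩ := nonempty_linearEquiv_prod_ker hfg
  -- Comparing `ψ` with `e` leaves `N₁` to be cancelled over `S`.
  let ψ : (S ⊗[R] M) ≃ₗ[S] N₁ × (S ⊗[R] LinearMap.ker g) :=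
    (φ.baseChange R S _ _).trans ((TensorProduct.prodRight R S S _ _).trans
      (e₁.prodCongr (LinearEquiv.refl S _)))
  exact ⟨LinearMap.ker g, _, _, nonempty_linearEquiv_of_prod (ψ.symm.trans e)⟩

theorem proposition3p1 (R : Type u) (S : Type v) [CommRing R] [CommRing S]
    [IsLocalRing R] [IsLocalRing S] [IsNoetherianRing R] [IsNoetherianRing S]
    [Algebra R S] [IsLocalHom (algebraMap R S)] [Module.Flat R S]
    (N₁ : Type w₁) (N₂ : Type w₂) [AddCommGroup N₁] [AddCommGroup N₂] [Module S N₁] [Module S N₂]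
    [Module.Finite S N₁] [Module.Finite S N₂] :
    (IsExtended R S N₁ → IsExtended R S N₂ → IsExtended R S (N₁ × N₂)) ∧
    (IsExtended R S N₁ → IsExtended R S (N₁ × N₂) → IsExtended R S N₂) ∧
    (IsExtended R S N₂ → IsExtended R S (N₁ × N₂) → IsExtended R S N₁) := by
  exact ⟨.prod, .of_prod_left, fun h₂ h ↦ h₂.of_prod_left (h.congr (LinearEquiv.prodComm S N₁ N₂))⟩
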